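/- All algebras are over $\mathbb C$. An $F$-algebra is an algebra (not necessarily unital) with a completely metrizable vector space topology for which the multiplication is jointly continuous. A family $(g_i)_{i\in I}$ in a commutative algebra is free if $P((g_i)_{i\in I})\neq 0$ for every nonzero polynomial $P$ without constant term in the variables $(x_i)_{i\in I}$; it freely generates the subalgebra it generates, which consists of the values $P((g_i)_{i\in I})$ of all polynomials $P$ without constant term. A vector $x$ is hypercyclic for $T$ if its orbit $\{T^n x: n\ge 0\}$ is dense. Let $X$ be a separable commutative $F$-algebra that has a dense subalgebra freely generated by a non-empty set, and let $T$ be a continuous linear operator on $X$. Suppose there exist a function $E:\mathbb C\to X$ and an entire function $\varphi:\mathbb C\to\mathbb C$ with $|\varphi(0)|=1$ such that (a) $T E(\lambda)=\varphi(\lambda)E(\lambda)$ for all $\lambda\in\mathbb C$; (b) $E(\lambda)E(\mu)=E(\lambda+\mu)$ for all $\lambda,\mu\in\mathbb C$; (c) for every $\Lambda\subset\mathbb C$ that has an accumulation point in $\mathbb C$, the linear span of $\{E(\lambda):\lambda\in\Lambda\}$ is dense in $X$; (d) the integer $\min\{n\ge 1:\varphi^{(n)}(0)\ne 0\}$ exists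 and is odd, and there are $\theta\in[0,2\pi)$ and $r,R>0$ such that $|\varphi(te^{i\theta})|<1$ for $0<t<r$ and $|\varphi(Re^{i\theta})|>\max\{1,e^{h_\varphi(\theta)R}\}$, where $h_\varphi(\theta)=\limsup_{t\to\infty}\log\big(|\varphi(te^{i\theta})|^{1/t}\big)\in[-\infty,\infty]$ (with $\log 0=-\infty$, $e^{-\infty}=0$, $e^{\infty}=\infty$). Then there is a dense $G_\delta$ subset $G$ of $X^{\mathbb N}$ (product topology) such that every $f=(f_n)_{n=1}^\infty\in G$ freely generates a dense subalgebra of $X$ all of whose nonzero elements are hypercyclic vectors for $T$. -/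

import Mathlib

open Filter Topology TopologicalSpace

/-- `x` is a hypercyclic vector for `T`: its orbit `x, T x, T (T x), …` is dense. -/
def IsHypercyclicVector {X : Type*} [TopologicalSpace X] (T : X → X) (x : X) : Prop :=
  Dense (Set.range fun n : ℕ => T^[n] x)

/-- A family `f` in a commutative complex algebra `X` (with or without unit) is free if no nonzero
polynomial without constant term vanishes at `f`; equivalently, the monomials `∏ (f i) ^ (a i)`,
with `a` ranging over the nonzero finitely supported exponents, are linearly independent. As `X`
need not have a unit, the polynomial is evaluated in `Unitization ℂ X`, which contains `X`; the
value of a polynomial without constant term lies in `X`. -/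
def IsFreeFamily {X : Type*} [NonUnitalCommRing X] [Module ℂ X] [IsScalarTower ℂ X X]
    [SMulCommClass ℂ X X] {ι : Type*} (f : ι → X) : Prop :=
  ∀ p : MvPolynomial ι ℂ, MvPolynomial.constantCoeff p = 0 →
    MvPolynomial.aeval (fun i => (f i : Unitization ℂ X)) p = 0 → p = 0

/-- `f` freely generates a dense subalgebra of `X`. The subalgebra generated by `f` consists of the
values at `f` of the polynomials without constant term. -/
def FreelyGeneratesDense {X : Type*} [NonUnitalCommRing X] [Module ℂ X] [IsScalarTower ℂ X X]
    [SMulCommClass ℂ X X] [TopologicalSpace X] {ι : Type*} (f : ι → X) : Prop :=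
  IsFreeFamily f ∧ Dense (NonUnitalAlgebra.adjoin ℂ (Set.range f) : Set X)

/-- The Phragmén–Lindelöf indicator `h_φ(θ) = limsup_{t → ∞} log (|φ(t e^{iθ})|^{1/t})`, an
extended real number (`log 0 = -∞`). -/
noncomputable def plIndicator (φ : ℂ → ℂ) (θ : ℝ) : EReal :=
  limsup (fun t : ℝ => ENNReal.log (‖φ (t * Complex.exp (θ * Complex.I))‖ₑ ^ (1 / t))) atTop

/-! The vector `E 0` is a unit of `X`, and products of eigenvectors are again eigenvectors: `E z * E
w` has eigenvalue `φ (z + w)`. By Baire's theorem it suffices that every finite set `A` of nonzero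
exponents contains some `β`, independent of the target, such that for a dense set of sequences `f`
some `T^q` sends the monomial `f^β` near a prescribed vector and all other `f^α`, `α ∈ A`, near 0.
Generic `f` then makes `p(f)` hypercyclic for every nonzero `p` without constant term, which also
yields freeness.

For this density (`exists_dense_hittingSet`), the variables get integer weights that separate the
elements of `A`, and `β` has the largest weight `W`. Each coordinate is approximated by a
combination of vectors `E y`, with `y` small in the direction where `‖φ‖ < 1`, and perturbed by
terms `b(x)^ρ φ(x)^(-qρ) E(ρx)` with `ρ = w i / W` and `‖φ x‖ > 1`, which vanish as `q → ∞`. When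
`T^q` acts on a monomial of weight `W`, the choices of one common `x` in all factors contribute
exactly `b(x) E(x)`.

All other products must decay, which is what `exists_spectral_sets` provides. The points `x` lie on
a short segment near some `z` with `‖φ(tz)‖ < ‖φ z‖^t` for `t = k/W`, which handles partial weight
`k < W`; `log ‖φ‖` is strictly convex along the segment, so Jensen's inequality handles unequal `x`.
Such a `z` is obtained from the least maximizer of `‖φ(te)‖^(1/t)`, moved slightly to where the
logarithmic derivative has nonzero derivative (`exists_convexity_point`). -/

/-! ### Growth and convexity of `log ‖φ‖`. -/

/-- The largest value of `u t ^ (1 / t)` is first attained at a point `R'` where `u` grows strictly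
faster than on the whole segment before it. -/
lemma exists_radial_growth {u : ℝ → ℝ} (hu : Continuous u) (hu0 : ∀ t, 0 ≤ u t) {r R : ℝ}
    (hr : 0 < r) (hR : 0 < R) (hlt : ∀ t, 0 < t → t < r → u t < 1) (hgt : 1 < u R) :
    ∃ R' : ℝ, 0 < R' ∧ 1 < u R' ∧ ∀ t : ℝ, 0 < t → t < 1 → u (t * R') < u R' ^ t := by
  have hrR : r ≤ R := by
    by_contra! h
    exact absurd (hlt R hR h) hgt.le.not_gt
  have hpos : ∀ t ∈ Set.Icc (r / 2) R, 0 < t := fun t ht => by linarith [ht.1]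
  -- Starting at `r / 2` avoids the singularity of `1 / t` at 0; below it `u < 1` is enough.
  have hg : ContinuousOn (fun t => u t ^ (1 / t)) (Set.Icc (r / 2) R) := by
    refine ContinuousOn.rpow hu.continuousOn ?_ ?_
    · exact continuousOn_const.div continuousOn_id fun t ht => (hpos t ht).ne'
    · intro t ht
      exact Or.inr (one_div_pos.2 (hpos t ht))
  have hRmem : R ∈ Set.Icc (r / 2) R := ⟨by linarith, le_rfl⟩
  obtain ⟨M, hM, hMmax⟩ := isCompact_Icc.exists_isMaxOn ⟨R, hRmem⟩ hg
  -- The least maximizer is taken: minimality makes the inequality strict at earlier points.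
  have hS : IsClosed (Set.Icc (r / 2) R ∩ (fun t => u t ^ (1 / t)) ⁻¹' Set.Ici (u M ^ (1 / M))) :=
    hg.preimage_isClosed_of_isClosed isClosed_Icc isClosed_Ici
  obtain ⟨R', hR', hleast⟩ :=
    (isCompact_Icc.of_isClosed_subset hS Set.inter_subset_left).exists_isLeast ⟨M, hM, le_refl (u M ^ (1 / M))⟩
  have hR'0 := hpos R' hR'.1
  have hgR' : 1 < u R' ^ (1 / R') := calc
    1 < u R ^ (1 / R) := Real.one_lt_rpow hgt (one_div_pos.2 hR)
    _ ≤ u M ^ (1 / M) := hMmax hRmem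
    _ ≤ u R' ^ (1 / R') := hR'.2
  have hu1 : 1 < u R' := by
    by_contra! h
    exact absurd (Real.rpow_le_one (hu0 R') h (one_div_pos.2 hR'0).le) hgR'.not_ge
  refine ⟨R', hR'0, hu1, fun t ht0 ht1 => ?_⟩
  have hτ : 0 < t * R' := mul_pos ht0 hR'0
  by_cases hcase : t * R' < r / 2
  · exact (hlt _ hτ (by linarith)).trans (Real.one_lt_rpow hu1 ht0)
  · have hlt' : t * R' < R' := by nlinarith
    have hmem : t * R' ∈ Set.Icc (r / 2) R := ⟨not_lt.1 hcase, hlt'.le.trans hR'.1.2⟩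
    have h1 : u (t * R') ^ (1 / (t * R')) < u R' ^ (1 / R') := by
      by_contra! h
      exact absurd (hleast ⟨hmem, hR'.2.trans h⟩) hlt'.not_ge
    have h2 := Real.rpow_lt_rpow (Real.rpow_nonneg (hu0 _) _) h1 hτ
    rw [← Real.rpow_mul (hu0 _), ← Real.rpow_mul (hu0 _), one_div_mul_cancel hτ.ne',
      Real.rpow_one] at h2
    convert h2 using 2
    field_simp

/-- Dividing by `F s` moves the value at `s` to 1, where the principal logarithm is differentiable,
so the branch cut plays no role. -/
lemma hasDerivAt_log_norm {F : ℝ → ℂ} {F' : ℂ} {s : ℝ} (hF : HasDerivAt F F' s) (h0 : F s ≠ 0) :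
    HasDerivAt (fun t => Real.log ‖F t‖) (F' / F s).re s := by
  have h1 : HasDerivAt (fun t => F t / F s) (F' / F s) s := hF.div_const _
  have h2 : HasDerivAt (fun t => Complex.log (F t / F s)) (F' / F s) s := by
    have := h1.clog_real (by rw [div_self h0]; exact Complex.one_mem_slitPlane)
    rwa [div_self h0, div_one] at this
  have h3 : HasDerivAt (fun t => (Complex.log (F t / F s)).re + Real.log ‖F s‖) (F' / F s).re s :=
    (Complex.reCLM.hasFDerivAt.comp_hasDerivAt s h2).add_const _
  refine h3.congr_of_eventuallyEq ?_
  filter_upwards [hF.continuousAt.eventually_ne h0] with t ht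
  rw [Complex.log_re, norm_div, Real.log_div (norm_ne_zero_iff.2 ht) (norm_ne_zero_iff.2 h0)]
  ring

/-- Where the second logarithmic derivative does not vanish, `log ‖φ‖` is strictly convex along
some short segment. -/
lemma exists_strictConvexOn_log_norm {φ : ℂ → ℂ} (hφ : Differentiable ℂ φ) {z : ℂ} (hz : φ z ≠ 0)
    (hD : deriv (deriv φ) z * φ z - deriv φ z ^ 2 ≠ 0) :
    ∃ v : ℂ, v ≠ 0 ∧ ∃ δ > 0,
      StrictConvexOn ℝ (Set.Ioo (-δ) δ) (fun s : ℝ => Real.log ‖φ (z + s * v)‖) := by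
  have hφ' : Differentiable ℂ (deriv φ) := (hφ.contDiff (n := 2)).differentiable_deriv_two
  have hφ'' : Continuous (deriv (deriv φ)) := (hφ'.contDiff (n := 1)).continuous_deriv_one
  set Q : ℂ → ℂ := fun y => (deriv (deriv φ) y * φ y - deriv φ y ^ 2) / φ y ^ 2 with hQ
  have hQz : Q z ≠ 0 := div_ne_zero hD (pow_ne_zero _ hz)
  -- `Q` is the derivative of `φ'/φ`, and the second derivative of `log ‖φ (z + s v)‖` is `Re (Q
  -- v²)`. With `v²` the conjugate of `Q z` this equals `|Q z|² > 0` at `s = 0`.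
  obtain ⟨v, hv⟩ := IsAlgClosed.exists_pow_nat_eq (starRingEnd ℂ (Q z)) two_pos
  have hv0 : v ≠ 0 := by
    rintro rfl
    rw [zero_pow two_ne_zero] at hv
    exact hQz ((map_eq_zero _).1 hv.symm)
  have hline : Continuous fun s : ℝ => z + s * v := by fun_prop
  have hev : ∀ᶠ s : ℝ in 𝓝 0, φ (z + s * v) ≠ 0 ∧ 0 < (Q (z + s * v) * v ^ 2).re := by
    have e0 : z + ((0 : ℝ) : ℂ) * v = z := by simp
    refine ((hφ.continuous.comp hline).continuousAt.eventually_ne (by simpa using hz)).and ?_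
    have hc : ContinuousAt (fun s : ℝ => (Q (z + s * v) * v ^ 2).re) 0 := by
      refine Complex.continuous_re.continuousAt.comp (ContinuousAt.mul ?_ continuousAt_const)
      refine ContinuousAt.div ?_ ?_ ?_
      · exact ((hφ''.mul hφ.continuous).sub (hφ'.continuous.pow 2)).continuousAt.comp
          hline.continuousAt
      · exact (hφ.continuous.pow 2).continuousAt.comp hline.continuousAt
      · rw [e0]; exact pow_ne_zero _ hz
    refine continuousAt_const.eventually_lt hc ?_
    rw [e0, hv, Complex.mul_conj, Complex.ofReal_re]
    exact Complex.normSq_pos.2 hQz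
  obtain ⟨δ, hδ, hball⟩ := Metric.eventually_nhds_iff.1 hev
  have hI : ∀ s ∈ Set.Ioo (-δ) δ, φ (z + s * v) ≠ 0 ∧ 0 < (Q (z + s * v) * v ^ 2).re := by
    intro s hs
    exact hball (by rw [Real.dist_eq, sub_zero]; exact abs_lt.2 hs)
  have hlined : ∀ s : ℝ, HasDerivAt (fun s : ℝ => z + s * v) v s := fun s => by
    simpa using ((Complex.ofRealCLM.hasDerivAt (x := s)).mul_const v).const_add z
  have hd : ∀ s : ℝ, HasDerivAt (fun s : ℝ => φ (z + s * v)) (deriv φ (z + s * v) * v) s :=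
    fun s => (hφ _).hasDerivAt.comp_of_eq s (hlined s) rfl
  have hd' : ∀ s : ℝ, HasDerivAt (fun s : ℝ => deriv φ (z + s * v) * v)
      (deriv (deriv φ) (z + s * v) * v * v) s :=
    fun s => ((hφ' _).hasDerivAt.comp_of_eq s (hlined s) rfl).mul_const v
  have h1 : ∀ s ∈ Set.Ioo (-δ) δ, HasDerivAt (fun s : ℝ => Real.log ‖φ (z + s * v)‖)
      (deriv φ (z + s * v) * v / φ (z + s * v)).re s :=
    fun s hs => hasDerivAt_log_norm (hd s) (hI s hs).1
  refine ⟨v, hv0, δ, hδ, strictConvexOn_of_deriv2_pos (convex_Ioo _ _)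
    (fun s hs => (h1 s hs).continuousAt.continuousWithinAt) fun s hs => ?_⟩
  rw [interior_Ioo] at hs
  have h2 : HasDerivAt (fun s : ℝ => (deriv φ (z + s * v) * v / φ (z + s * v)).re)
      (Q (z + s * v) * v ^ 2).re s := by
    have := Complex.reCLM.hasFDerivAt.comp_hasDerivAt s ((hd' s).div (hd s) (hI s hs).1)
    refine this.congr_deriv (congrArg Complex.re ?_)
    simp only [hQ]
    ring
  have h3 : deriv (fun s : ℝ => Real.log ‖φ (z + s * v)‖) =ᶠ[𝓝 s]
      fun s : ℝ => (deriv φ (z + s * v) * v / φ (z + s * v)).re := by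
    filter_upwards [isOpen_Ioo.mem_nhds hs] with y hy using (h1 y hy).deriv
  simp only [Function.iterate_succ, Function.iterate_zero, Function.comp_apply, id]
  rw [h3.deriv_eq, h2.deriv]
  exact (hI s hs).2

/-- An entire function whose logarithmic derivative is locally constant is an exponential. -/
lemma eq_mul_exp_of_deriv2_mul_eq {φ : ℂ → ℂ} (hφ : Differentiable ℂ φ) (h0 : φ 0 ≠ 0) {z₀ : ℂ}
    (hD : ∀ᶠ z in 𝓝 z₀, deriv (deriv φ) z * φ z - deriv φ z ^ 2 = 0) :
    ∃ b : ℂ, ∀ z, φ z = φ 0 * Complex.exp (b * z) := by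
  have hφ' : Differentiable ℂ (deriv φ) := (hφ.contDiff (n := 2)).differentiable_deriv_two
  have hφ'' : Differentiable ℂ (deriv (deriv φ)) :=
    (hφ'.contDiff (n := 2)).differentiable_deriv_two
  -- The expression is entire even where `φ` vanishes, so the identity theorem applies without
  -- division.
  have hDall : (fun z => deriv (deriv φ) z * φ z - deriv φ z ^ 2) = fun _ => 0 :=
    AnalyticOnNhd.eq_of_eventuallyEq
      (fun z _ => ((hφ''.mul hφ).sub (hφ'.pow 2)).analyticAt z)
      (fun z _ => analyticAt_const) hD
  obtain ⟨δ, hδ, hne⟩ := Metric.eventually_nhds_iff_ball.1 (hφ.continuous.continuousAt.eventually_ne h0)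
  set b := deriv φ 0 / φ 0 with hb
  have hconst : ∀ z ∈ Metric.ball (0 : ℂ) δ, deriv φ z / φ z = b := by
    intro z hz
    refine Metric.isOpen_ball.is_const_of_deriv_eq_zero (f := fun z => deriv φ z / φ z)
      (convex_ball _ _).isPreconnected ?_ ?_ hz (Metric.mem_ball_self hδ)
    · exact hφ'.differentiableOn.div hφ.differentiableOn hne
    · intro y hy
      have := ((hφ' y).hasDerivAt.div (hφ y).hasDerivAt (hne y hy)).deriv
      have hDy := congrFun hDall y
      simp only [Pi.zero_apply]
      refine this.trans ?_
      rw [← sq, hDy, zero_div]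
  have hODE : (fun z => deriv φ z - b * φ z) = fun _ => 0 := by
    refine AnalyticOnNhd.eq_of_eventuallyEq (z₀ := (0 : ℂ))
      (fun z _ => (hφ'.sub (hφ.const_mul b)).analyticAt z) (fun z _ => analyticAt_const) ?_
    filter_upwards [Metric.ball_mem_nhds (0 : ℂ) hδ] with z hz
    rw [← hconst z hz, div_mul_cancel₀ _ (hne z hz), sub_self]
  have hder : ∀ z, HasDerivAt (fun z => φ z * Complex.exp (-(b * z))) 0 z := by
    intro z
    have h1 : HasDerivAt (fun z => Complex.exp (-(b * z))) (Complex.exp (-(b * z)) * -b) z := by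
      simpa using (((hasDerivAt_id z).const_mul b).neg).cexp
    refine ((hφ z).hasDerivAt.mul h1).congr_deriv ?_
    have := congrFun hODE z
    linear_combination Complex.exp (-(b * z)) * this
  refine ⟨b, fun z => ?_⟩
  have := is_const_of_deriv_eq_zero (fun z => (hder z).differentiableAt) (fun z => (hder z).deriv) z 0
  simp only [mul_zero, neg_zero, Complex.exp_zero, mul_one] at this
  rw [← this, mul_assoc, ← Complex.exp_add, neg_add_cancel, Complex.exp_zero, mul_one]

/-- A point outside the closed unit level set of `φ` at which `log ‖φ‖` dominates its values on a
finite part of the segment from the origin, and is strictly convex in some direction. -/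
lemma exists_convexity_point {φ : ℂ → ℂ} (hφ : Differentiable ℂ φ) (hφ0 : ‖φ 0‖ = 1) {e : ℂ}
    {r R : ℝ} (hr : 0 < r) (hR : 0 < R) (hlt : ∀ t : ℝ, 0 < t → t < r → ‖φ (t * e)‖ < 1)
    (hgt : 1 < ‖φ (R * e)‖) (F : Finset ℝ) (hF : ∀ t ∈ F, 0 < t ∧ t < 1) :
    ∃ z : ℂ, 1 < ‖φ z‖ ∧ deriv (deriv φ) z * φ z - deriv φ z ^ 2 ≠ 0 ∧
      ∀ t ∈ F, ‖φ (t * z)‖ < ‖φ z‖ ^ t := by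
  have hcont := hφ.continuous
  have hφ00 : φ 0 ≠ 0 := by
    rw [← norm_ne_zero_iff, hφ0]; exact one_ne_zero
  obtain ⟨R', hR'0, hR'1, hR'⟩ := exists_radial_growth (u := fun t : ℝ => ‖φ (t * e)‖)
    (by fun_prop) (fun _ => norm_nonneg _) hr hR hlt hgt
  -- Otherwise `φ` is a multiple of an exponential and `‖φ (t e)‖ = exp (t Re (b e))`, which cannot
  -- be below 1 for small `t` and above 1 at `R`.
  have hfreq : ∃ᶠ z in 𝓝 ((R' : ℂ) * e), deriv (deriv φ) z * φ z - deriv φ z ^ 2 ≠ 0 := by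
    intro hnot
    obtain ⟨b, hb⟩ := eq_mul_exp_of_deriv2_mul_eq hφ hφ00 (hnot.mono fun z hz => not_not.1 hz)
    have hn : ∀ t : ℝ, ‖φ (t * e)‖ = Real.exp (t * (b * e).re) := by
      intro t
      rw [hb, norm_mul, hφ0, one_mul, Complex.norm_exp]
      congr 1
      rw [mul_left_comm, Complex.re_ofReal_mul]
    have h1 := hlt (r / 2) (by linarith) (by linarith)
    rw [hn, Real.exp_lt_one_iff] at h1
    rw [hn, Real.one_lt_exp_iff] at hgt
    have := (pos_iff_pos_of_mul_pos hgt).1 hR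
    nlinarith
  have hev : ∀ᶠ z in 𝓝 ((R' : ℂ) * e), 1 < ‖φ z‖ ∧ ∀ t ∈ F, ‖φ (t * z)‖ < ‖φ z‖ ^ t := by
    refine (continuousAt_const.eventually_lt hcont.norm.continuousAt hR'1).and ?_
    refine (Filter.eventually_all_finset F).2 fun t ht => ?_
    refine ContinuousAt.eventually_lt (by fun_prop) ?_ ?_
    · exact hcont.norm.continuousAt.rpow_const (Or.inr (hF t ht).1.le)
    · have := hR' t (hF t ht).1 (hF t ht).2
      simp only [Complex.ofReal_mul, mul_assoc] at this
      exact this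
  obtain ⟨z, hz1, hz2⟩ := (hfreq.and_eventually hev).exists
  exact ⟨z, hz2.1, hz1, hz2.2⟩

/-! ### Sets of spectral parameters. -/

/-- The exponent contributed by a factor of weight `ρ`: small points enter as they are, the others
are scaled by `ρ`. -/
noncomputable def scaledPoint (ρ : ℝ) (c : ℂ ⊕ ℂ) : ℂ :=
  Sum.elim (fun y => y) (fun x => (ρ : ℂ) * x) c

/-- The exponential rate at which the coefficient of a factor of weight `ρ` decays. -/
noncomputable def decayRate (φ : ℂ → ℂ) (ρ : ℝ) (c : ℂ ⊕ ℂ) : ℝ :=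
  Sum.elim (fun _ => 0) (fun x => ρ * Real.log ‖φ x‖) c

lemma accPt_image_of_injective {g : ℝ → ℂ} (hg : Continuous g) (hinj : Function.Injective g)
    {s : Set ℝ} {x : ℝ} (h : AccPt x (𝓟 s)) : AccPt (g x) (𝓟 (g '' s)) := by
  rw [accPt_iff_frequently] at h ⊢
  refine hg.continuousAt.tendsto.frequently (h.mono ?_)
  rintro y ⟨hy, hys⟩
  exact ⟨hinj.ne hy, y, hys, rfl⟩

lemma accPt_zero_Ioo {δ : ℝ} (hδ : 0 < δ) : AccPt (0 : ℝ) (𝓟 (Set.Ioo 0 δ)) := by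
  have : (0 : ℝ) ∈ closure (Set.Ioo 0 δ) := by
    rw [closure_Ioo hδ.ne]; exact ⟨le_rfl, hδ.le⟩
  rw [accPt_principal_iff_clusterPt, Set.sdiff_singleton_eq_self (by simp)]
  exact mem_closure_iff_clusterPt.1 this

/-- Let `k` be the weight of the factors choosing a point of `B`. If `k = 0`, the sum is a small
positive multiple of `e`, where `‖φ‖ < 1`. If `0 < k < W`, it is close to `(k/W) z` and radial
growth applies. If `k = W`, the points of `B` are not all equal and strict convexity applies. -/
theorem exists_spectral_sets {φ : ℂ → ℂ} (hφ : Differentiable ℂ φ) (hφ0 : ‖φ 0‖ = 1) {e : ℂ}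
    {r R : ℝ} (hr : 0 < r) (hR : 0 < R) (hlt : ∀ t : ℝ, 0 < t → t < r → ‖φ (t * e)‖ < 1)
    (hgt : 1 < ‖φ (R * e)‖) {W : ℕ} (hW : 0 < W) :
    ∃ A B : Set ℂ, (∃ z, AccPt z (𝓟 A)) ∧ (∃ z, AccPt z (𝓟 B)) ∧ (∀ x ∈ B, 1 < ‖φ x‖) ∧
      ∀ (ι : Type) [Fintype ι] [Nonempty ι] (w : ι → ℕ) (c : ι → ℂ ⊕ ℂ), (∀ s, 0 < w s) →
        ∑ s, w s ≤ W → (∀ s, Sum.elim (· ∈ A) (· ∈ B) (c s)) →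
        ¬ (∑ s, w s = W ∧ ∃ x, ∀ s, c s = Sum.inr x) →
        ‖φ (∑ s, scaledPoint (w s / W) (c s))‖ <
          Real.exp (∑ s, decayRate φ (w s / W) (c s)) := by
  have hcont := hφ.continuous
  have hWR : (0 : ℝ) < W := by exact_mod_cast hW
  have he : e ≠ 0 := by
    rintro rfl
    simp [hφ0] at hgt
  obtain ⟨z, hz1, hzD, hzF⟩ := exists_convexity_point hφ hφ0 hr hR hlt hgt
    ((Finset.Ioo 0 W).image fun k : ℕ => (k / W : ℝ)) (by
      intro t ht
      obtain ⟨k, hk, rfl⟩ := Finset.mem_image.1 ht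
      rw [Finset.mem_Ioo] at hk
      have h1 : (0 : ℝ) < k := by exact_mod_cast hk.1
      have h2 : (k : ℝ) < W := by exact_mod_cast hk.2
      exact ⟨by positivity, (div_lt_one hWR).2 h2⟩)
  have hz0 : 0 < ‖φ z‖ := one_pos.trans hz1
  have hzF' : ∀ k ∈ Finset.Ioo 0 W, ‖φ (((k / W : ℝ) : ℂ) * z)‖ <
      Real.exp ((k / W : ℝ) * Real.log ‖φ z‖) := by
    intro k hk
    have := hzF _ (Finset.mem_image_of_mem _ hk)
    rwa [Real.rpow_def_of_pos hz0, mul_comm (Real.log _)] at this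
  -- The slack `m` serves as a uniform lower bound for `log ‖φ x‖` near `z`.
  obtain ⟨m, hm, hmF⟩ : ∃ m < Real.log ‖φ z‖, ∀ k ∈ Finset.Ioo 0 W,
      ‖φ (((k / W : ℝ) : ℂ) * z)‖ < Real.exp ((k / W : ℝ) * m) := by
    have : ∀ᶠ m in 𝓝[<] (Real.log ‖φ z‖), m < Real.log ‖φ z‖ ∧ ∀ k ∈ Finset.Ioo 0 W,
        ‖φ (((k / W : ℝ) : ℂ) * z)‖ < Real.exp ((k / W : ℝ) * m) := by
      refine (eventually_mem_nhdsWithin).and (eventually_nhdsWithin_of_eventually_nhds ?_)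
      refine (Filter.eventually_all_finset _).2 fun k hk => ?_
      exact ContinuousAt.eventually_lt (by fun_prop) (by fun_prop) (hzF' k hk)
    exact this.exists
  obtain ⟨v, hv, δ, hδ, hconv⟩ := exists_strictConvexOn_log_norm hφ (norm_pos_iff.1 hz0) hzD
  have hnear : ∀ᶠ x in 𝓝 z, 1 < ‖φ x‖ ∧ m < Real.log ‖φ x‖ :=
    (continuousAt_const.eventually_lt hcont.norm.continuousAt hz1).and
      (continuousAt_const.eventually_lt (hcont.norm.continuousAt.log hz0.ne') hm)
  have hmix : ∀ᶠ p : ℂ × ℂ in 𝓝 (0, z), ∀ k ∈ Finset.Ioo 0 W,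
      ‖φ (p.1 + ((k / W : ℝ) : ℂ) * p.2)‖ < Real.exp ((k / W : ℝ) * m) := by
    refine (Filter.eventually_all_finset _).2 fun k hk => ?_
    refine ContinuousAt.eventually_lt (by fun_prop) continuousAt_const ?_
    simpa using hmF k hk
  rw [nhds_prod_eq] at hmix
  obtain ⟨pa, hpa, pb, hpb, hpab⟩ := Filter.eventually_prod_iff.1 hmix
  obtain ⟨η, hη, hηa⟩ := Metric.eventually_nhds_iff_ball.1 hpa
  obtain ⟨ε, hε, hεb⟩ := Metric.eventually_nhds_iff_ball.1 (hpb.and hnear)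
  have hen : 0 < ‖e‖ := norm_pos_iff.2 he
  have hvn : 0 < ‖v‖ := norm_pos_iff.2 hv
  obtain ⟨τ₀, hτ₀, hτr, hτη⟩ : ∃ τ₀ > 0, W * τ₀ ≤ r ∧ W * τ₀ * ‖e‖ ≤ η := by
    refine ⟨min (r / W) (η / (W * ‖e‖)), by positivity, ?_, ?_⟩
    · calc W * min (r / W) (η / (W * ‖e‖)) ≤ W * (r / W) := by gcongr; exact min_le_left _ _
        _ = r := by field_simp
    · calc W * min (r / W) (η / (W * ‖e‖)) * ‖e‖ ≤ W * (η / (W * ‖e‖)) * ‖e‖ := by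
            gcongr; exact min_le_right _ _
        _ = η := by field_simp
  obtain ⟨σ₀, hσ₀, hσδ, hσε⟩ : ∃ σ₀ > 0, σ₀ ≤ δ ∧ σ₀ * ‖v‖ ≤ ε := by
    refine ⟨min δ (ε / ‖v‖), by positivity, min_le_left _ _, ?_⟩
    calc min δ (ε / ‖v‖) * ‖v‖ ≤ ε / ‖v‖ * ‖v‖ := by gcongr; exact min_le_right _ _
      _ = ε := by field_simp
  have hBball : ∀ σ ∈ Set.Ioo 0 σ₀, z + (σ : ℂ) * v ∈ Metric.ball z ε := by
    intro σ hσ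
    rw [mem_ball_iff_norm, add_sub_cancel_left, norm_mul, Complex.norm_of_nonneg hσ.1.le]
    exact (mul_lt_mul_of_pos_right hσ.2 hvn).trans_le hσε
  refine ⟨(fun τ : ℝ => (τ : ℂ) * e) '' Set.Ioo 0 τ₀, (fun σ : ℝ => z + (σ : ℂ) * v) '' Set.Ioo 0 σ₀,
    ⟨_, accPt_image_of_injective (by fun_prop) ?_ (accPt_zero_Ioo hτ₀)⟩,
    ⟨_, accPt_image_of_injective (by fun_prop) ?_ (accPt_zero_Ioo hσ₀)⟩, ?_, ?_⟩
  · intro x y hxy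
    exact_mod_cast mul_right_cancel₀ he hxy
  · intro x y hxy
    exact_mod_cast mul_right_cancel₀ hv (add_left_cancel hxy)
  · rintro _ ⟨σ, hσ, rfl⟩
    exact (hεb _ (hBball σ hσ)).2.1
  intro ι _ _ w c hw hsum hc hnp
  have hrep : ∀ s, (∃ τ ∈ Set.Ioo 0 τ₀, c s = Sum.inl ((τ : ℂ) * e)) ∨
      ∃ σ ∈ Set.Ioo 0 σ₀, c s = Sum.inr (z + (σ : ℂ) * v) := by
    intro s
    have := hc s
    rcases h : c s with y | x <;> rw [h] at this
    · obtain ⟨τ, hτ, rfl⟩ := this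
      exact Or.inl ⟨τ, hτ, rfl⟩
    · obtain ⟨σ, hσ, rfl⟩ := this
      exact Or.inr ⟨σ, hσ, rfl⟩
  have hcardW : Fintype.card ι ≤ W := by
    calc Fintype.card ι = ∑ _s : ι, 1 := by simp
      _ ≤ ∑ s, w s := Finset.sum_le_sum fun s _ => hw s
      _ ≤ W := hsum
  -- Factors choosing a small point get weight 0 and the dummy point `z`, so every `x s` lies in the
  -- ball around `z`.
  set ω : ι → ℕ := fun s => Sum.elim (fun _ => 0) (fun _ => w s) (c s) with hω
  set y : ι → ℂ := fun s => Sum.elim (fun y => y) (fun _ => 0) (c s) with hy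
  set x : ι → ℂ := fun s => Sum.elim (fun _ => z) (fun x => x) (c s) with hx
  have hpt : ∀ s, scaledPoint (w s / W) (c s) = y s + ((ω s / W : ℝ) : ℂ) * x s := by
    intro s
    rcases h : c s with a | a <;> simp [scaledPoint, hω, hy, hx, h]
  have hrate : ∀ s, decayRate φ (w s / W) (c s) = (ω s / W : ℝ) * Real.log ‖φ (x s)‖ := by
    intro s
    rcases h : c s with a | a <;> simp [decayRate, hω, hx, h]
  have hωw : ∀ s, ω s ≤ w s := by
    intro s
    rcases h : c s with a | a <;> simp [hω, h]
  have hkle : ∑ s, ω s ≤ ∑ s, w s := Finset.sum_le_sum fun s _ => hωw s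
  have hxball : ∀ s, x s ∈ Metric.ball z ε := by
    intro s
    rcases hrep s with ⟨τ, hτ, h⟩ | ⟨σ, hσ, h⟩
    · simpa [hx, h] using hε
    · simpa only [hx, h, Sum.elim_inr] using hBball σ hσ
  have hynorm : ∀ s, ‖y s‖ < τ₀ * ‖e‖ := by
    intro s
    rcases hrep s with ⟨τ, hτ, h⟩ | ⟨σ, hσ, h⟩
    · simp only [hy, h, Sum.elim_inl, norm_mul, Complex.norm_of_nonneg hτ.1.le]
      exact mul_lt_mul_of_pos_right hτ.2 hen
    · simp only [hy, h, Sum.elim_inr, norm_zero]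
      positivity
  simp only [hpt, hrate, Finset.sum_add_distrib]
  rcases Nat.eq_zero_or_pos (∑ s, ω s) with hk0 | hkpos
  · have hω0 : ∀ s, ω s = 0 := fun s => Finset.sum_eq_zero_iff.1 hk0 s (Finset.mem_univ s)
    have hτ : ∀ s, ∃ τ ∈ Set.Ioo 0 τ₀, y s = (τ : ℂ) * e := by
      intro s
      rcases hrep s with ⟨τ, hτ, h⟩ | ⟨σ, hσ, h⟩
      · exact ⟨τ, hτ, by simp [hy, h]⟩
      · have := hω0 s
        simp only [hω, h, Sum.elim_inr] at this
        exact absurd this (hw s).ne'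
    choose τ hτ hyτ using hτ
    simp only [hω0, hyτ, Nat.cast_zero, zero_div, Complex.ofReal_zero, zero_mul,
      Finset.sum_const_zero, add_zero, Real.exp_zero, ← Finset.sum_mul]
    rw [← Complex.ofReal_sum]
    refine hlt _ (Finset.sum_pos (fun s _ => (hτ s).1) Finset.univ_nonempty) ?_
    calc ∑ s, τ s < ∑ _s : ι, τ₀ :=
          Finset.sum_lt_sum_of_nonempty Finset.univ_nonempty fun s _ => (hτ s).2
      _ = Fintype.card ι * τ₀ := by simp
      _ ≤ W * τ₀ := by gcongr
      _ ≤ r := hτr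
  rcases lt_or_eq_of_le (hkle.trans hsum) with hkW | hkW
  · set k := ∑ s, ω s with hk
    have hkR : (0 : ℝ) < k := by exact_mod_cast hkpos
    have hsum1 : ∑ s, (ω s / k : ℝ) = 1 := by
      rw [← Finset.sum_div, ← Nat.cast_sum, ← hk, div_self hkR.ne']
    have hbar : ∑ s, (ω s / k : ℝ) • x s ∈ Metric.ball z ε :=
      (convex_ball z ε).sum_mem (fun s _ => by positivity) hsum1 fun s _ => hxball s
    have hsumx : ∑ s, ((ω s / W : ℝ) : ℂ) * x s = ((k / W : ℝ) : ℂ) * ∑ s, (ω s / k : ℝ) • x s := by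
      rw [Finset.mul_sum]
      refine Finset.sum_congr rfl fun s _ => ?_
      rw [Complex.real_smul, ← mul_assoc, ← Complex.ofReal_mul]
      congr 2
      field_simp
    have hyball : ∑ s, y s ∈ Metric.ball (0 : ℂ) η := by
      rw [mem_ball_zero_iff]
      calc ‖∑ s, y s‖ ≤ ∑ s, ‖y s‖ := norm_sum_le _ _
        _ < ∑ _s : ι, τ₀ * ‖e‖ :=
          Finset.sum_lt_sum_of_nonempty Finset.univ_nonempty fun s _ => hynorm s
        _ = Fintype.card ι * (τ₀ * ‖e‖) := by simp
        _ ≤ W * (τ₀ * ‖e‖) := by gcongr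
        _ ≤ η := by rw [← mul_assoc]; exact hτη
    rw [hsumx]
    refine (hpab (hηa _ hyball) (hεb _ hbar).1 k (Finset.mem_Ioo.2 ⟨hkpos, hkW⟩)).trans_le ?_
    refine Real.exp_le_exp.2 ?_
    calc (k / W : ℝ) * m = ∑ s, (ω s / W : ℝ) * m := by
          rw [← Finset.sum_mul, ← Finset.sum_div, ← Nat.cast_sum]
      _ ≤ _ := Finset.sum_le_sum fun s _ =>
          mul_le_mul_of_nonneg_left (hεb _ (hxball s)).2.2.le (by positivity)
  · have hwW : ∑ s, w s = W := le_antisymm hsum (hkW ▸ hkle)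
    have hωeq : ∀ s, ω s = w s := fun s =>
      (Finset.sum_eq_sum_iff_of_le fun s _ => hωw s).1 (hkW.trans hwW.symm) s (Finset.mem_univ s)
    have hσ : ∀ s, ∃ σ ∈ Set.Ioo 0 σ₀, c s = Sum.inr (z + (σ : ℂ) * v) := by
      intro s
      rcases hrep s with ⟨τ, hτ, h⟩ | h
      · have := hωeq s
        simp only [hω, h, Sum.elim_inl] at this
        exact absurd this (hw s).ne
      · exact h
    choose σ hσ hcσ using hσ
    have hsum1 : ∑ s, (w s / W : ℝ) = 1 := by
      rw [← Finset.sum_div, ← Nat.cast_sum, hwW, div_self hWR.ne']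
    have hne : ∃ i ∈ Finset.univ, ∃ j ∈ Finset.univ, σ i ≠ σ j := by
      by_contra! hall
      obtain ⟨s₀⟩ := ‹Nonempty ι›
      refine hnp ⟨hwW, z + (σ s₀ : ℂ) * v, fun s => ?_⟩
      rw [hcσ s, hall s (Finset.mem_univ _) s₀ (Finset.mem_univ _)]
    have hlt' := hconv.map_sum_lt (t := Finset.univ) (w := fun s => (w s / W : ℝ)) (p := σ)
      (fun s _ => div_pos (by exact_mod_cast hw s) hWR) hsum1
      (fun s _ => ⟨by linarith [(hσ s).1], (hσ s).2.trans_le hσδ⟩) hne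
    have hxσ : ∀ s, x s = z + (σ s : ℂ) * v := fun s => by simp [hx, hcσ]
    have hyσ : ∀ s, y s = 0 := fun s => by simp [hy, hcσ]
    have hpoint : ∑ s, y s + ∑ s, ((ω s / W : ℝ) : ℂ) * x s =
        z + ((∑ s, (w s / W : ℝ) • σ s : ℝ) : ℂ) * v := by
      have h1 : ∑ s, ((w s / W : ℝ) : ℂ) = 1 := by exact_mod_cast hsum1
      simp only [hyσ, hxσ, hωeq, mul_add, Finset.sum_add_distrib, ← Finset.sum_mul, h1, one_mul,
        Finset.sum_const_zero, zero_add, ← mul_assoc, smul_eq_mul, Complex.ofReal_sum,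
        Complex.ofReal_mul]
    rw [hpoint]
    simp only [hxσ, hωeq]
    simp only [smul_eq_mul] at hlt' ⊢
    -- At a zero of `φ` the convention `Real.log 0 = 0` makes the convexity bound useless, but the
    -- claim is trivial.
    by_cases h0 : φ (z + ((∑ s, (w s / W : ℝ) * σ s : ℝ) : ℂ) * v) = 0
    · rw [h0, norm_zero]; exact Real.exp_pos _
    · exact (Real.log_lt_iff_lt_exp (norm_pos_iff.2 h0)).1 hlt'

/-! ### Perturbed combinations of eigenvectors and their iterates. -/

/-- Coefficients of a perturbed combination: those of `a` at the small points, and coefficients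
that decay like `‖φ x‖ ^ (-q ρ)` at the large ones. -/
noncomputable def perturbedCoeff (φ : ℂ → ℂ) (a b : ℂ →₀ ℂ) (ρ : ℝ) (q : ℕ) (c : ℂ ⊕ ℂ) : ℂ :=
  Sum.elim (fun y => a y)
    (fun x => Complex.exp (ρ * (Complex.log (b x) - q * Complex.log (φ x)))) c

lemma norm_perturbedCoeff (φ : ℂ → ℂ) (a b : ℂ →₀ ℂ) (ρ : ℝ) (q : ℕ) (c : ℂ ⊕ ℂ) :
    ‖perturbedCoeff φ a b ρ q c‖ =
      ‖perturbedCoeff φ a b ρ 0 c‖ * Real.exp (-decayRate φ ρ c) ^ q := by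
  rcases c with y | x
  · simp [perturbedCoeff, decayRate]
  · simp only [perturbedCoeff, decayRate, Sum.elim_inr, Complex.norm_exp, ← Real.exp_nat_mul,
      ← Real.exp_add, Complex.re_ofReal_mul, Complex.sub_re, Complex.log_re, Nat.cast_zero,
      zero_mul, sub_zero]
    rw [← Complex.ofReal_natCast q, Complex.re_ofReal_mul, Complex.log_re]
    congr 1
    ring

section Algebra

variable {X : Type*} [CommRing X]

lemma prod_eq_apply_sum {E : ℂ → X} (hE0 : E 0 = 1) (hE : ∀ z w, E z * E w = E (z + w))
    {ι : Type*} (s : Finset ι) (p : ι → ℂ) : ∏ i ∈ s, E (p i) = E (∑ i ∈ s, p i) := by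
  classical
  induction s using Finset.induction_on with
  | empty => simp [hE0]
  | insert i s hi ih => rw [Finset.prod_insert hi, Finset.sum_insert hi, ih, hE]

variable [Algebra ℂ X]

/-- The combination of the values of `E` with coefficients `perturbedCoeff`. -/
noncomputable def perturbedSum (E : ℂ → X) (φ : ℂ → ℂ) (a b : ℂ →₀ ℂ) (ρ : ℝ) (q : ℕ) : X :=
  ∑ c ∈ a.support.disjSum b.support, perturbedCoeff φ a b ρ q c • E (scaledPoint ρ c)

variable [TopologicalSpace X]

lemma iterate_apply_eigenvector {T : X →L[ℂ] X} {E : ℂ → X} {φ : ℂ → ℂ}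
    (hT : ∀ z, T (E z) = φ z • E z) (q : ℕ) (z : ℂ) : T^[q] (E z) = φ z ^ q • E z := by
  induction q with
  | zero => simp
  | succ q ih => rw [Function.iterate_succ_apply', ih, map_smul, hT, smul_smul, pow_succ]

lemma iterate_prod_perturbedSum {T : X →L[ℂ] X} {E : ℂ → X} {φ : ℂ → ℂ} (hE0 : E 0 = 1)
    (hE : ∀ z w, E z * E w = E (z + w)) (hT : ∀ z, T (E z) = φ z • E z) {ι : Type*} [Fintype ι]
    [DecidableEq ι] (a : ι → ℂ →₀ ℂ) (b : ℂ →₀ ℂ) (ρ : ι → ℝ) (q : ℕ) :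
    T^[q] (∏ s, perturbedSum E φ (a s) b (ρ s) q) =
      ∑ c ∈ Fintype.piFinset fun s => (a s).support.disjSum b.support,
        (φ (∑ s, scaledPoint (ρ s) (c s)) ^ q * ∏ s, perturbedCoeff φ (a s) b (ρ s) q (c s)) •
          E (∑ s, scaledPoint (ρ s) (c s)) := by
  unfold perturbedSum
  have hpow : T^[q] = ⇑((T : X →ₗ[ℂ] X) ^ q) := (Module.End.coe_pow _ _).symm
  rw [Finset.prod_univ_sum, hpow, map_sum]
  refine Finset.sum_congr rfl fun c _ => ?_
  rw [Finset.prod_smul, prod_eq_apply_sum hE0 hE, map_smul, ← hpow,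
    iterate_apply_eigenvector hT, smul_smul, mul_comm]

/-- Isolates the diagonal terms, the only ones that survive in the limit; `s₀` merely reads off the
common value. -/
lemma sum_constant_choices {M : Type*} [AddCommMonoid M] {ι : Type*} [Fintype ι] [DecidableEq ι]
    (s₀ : ι) (a : ι → ℂ →₀ ℂ) (b : ℂ →₀ ℂ) (g : ℂ → M)
    [DecidablePred fun c : ι → ℂ ⊕ ℂ => ∃ x, ∀ s, c s = Sum.inr x] :
    ∑ c ∈ Fintype.piFinset fun s => (a s).support.disjSum b.support,
      (if ∃ x, ∀ s, c s = Sum.inr x then Sum.elim (fun _ => 0) g (c s₀) else 0) =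
      ∑ x ∈ b.support, g x := by
  rw [← Finset.sum_filter]
  symm
  refine Finset.sum_nbij' (fun x _ => Sum.inr x) (fun c => Sum.elim id id (c s₀)) ?_ ?_ ?_ ?_ ?_
  · intro x hx
    simp only [Finset.mem_filter, Fintype.mem_piFinset, Finset.inr_mem_disjSum]
    exact ⟨fun _ => hx, x, fun _ => rfl⟩
  · intro c hc
    simp only [Finset.mem_filter, Fintype.mem_piFinset] at hc
    obtain ⟨h, x, hx⟩ := hc
    have := h s₀
    rw [hx s₀, Finset.inr_mem_disjSum] at this
    simpa [hx s₀] using this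
  · intro x _
    rfl
  · intro c hc
    obtain ⟨-, x, hx⟩ := Finset.mem_filter.1 hc
    funext s
    simp [hx]
  · intro x _
    rfl

variable [ContinuousSMul ℂ X] [ContinuousAdd X]

/-- For a constant choice `x` of total weight `W` the exponents `w s / W` sum to 1, so the
coefficient `b x / φ x ^ q` cancels the eigenvalue power exactly. Every other term is bounded by a
geometric sequence of ratio `θ < 1`. -/
theorem tendsto_iterate_prod_perturbedSum {T : X →L[ℂ] X} {E : ℂ → X} {φ : ℂ → ℂ} (hE0 : E 0 = 1)
    (hE : ∀ z w, E z * E w = E (z + w)) (hT : ∀ z, T (E z) = φ z • E z) {W : ℕ} (hW : 0 < W)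
    {A B : Set ℂ} {ι : Type} [Fintype ι] [Nonempty ι] (w : ι → ℕ) (hB : ∀ x ∈ B, 1 < ‖φ x‖)
    (hAB : ∀ c : ι → ℂ ⊕ ℂ, (∀ s, Sum.elim (· ∈ A) (· ∈ B) (c s)) →
        ¬ (∑ s, w s = W ∧ ∃ x, ∀ s, c s = Sum.inr x) →
        ‖φ (∑ s, scaledPoint (w s / W) (c s))‖ < Real.exp (∑ s, decayRate φ (w s / W) (c s)))
    (a : ι → ℂ →₀ ℂ) (b : ℂ →₀ ℂ) (ha : ∀ s, ((a s).support : Set ℂ) ⊆ A)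
    (hb : (b.support : Set ℂ) ⊆ B) :
    Tendsto (fun q : ℕ => T^[q] (∏ s, perturbedSum E φ (a s) b (w s / W) q)) atTop
      (𝓝 (if ∑ s, w s = W then ∑ x ∈ b.support, b x • E x else 0)) := by
  classical
  obtain ⟨s₀⟩ := ‹Nonempty ι›
  have hlim : (if ∑ s, w s = W then ∑ x ∈ b.support, b x • E x else 0) =
      ∑ c ∈ Fintype.piFinset fun s => (a s).support.disjSum b.support,
        if ∑ s, w s = W ∧ ∃ x, ∀ s, c s = Sum.inr x then
          Sum.elim (fun _ => 0) (fun x => b x • E x) (c s₀) else 0 := by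
    by_cases h : ∑ s, w s = W
    · simp only [h, true_and, if_true]
      exact (sum_constant_choices s₀ a b fun x => b x • E x).symm
    · simp [h]
  rw [hlim]
  simp only [iterate_prod_perturbedSum hE0 hE hT]
  refine tendsto_finsetSum _ fun c hc => ?_
  rw [Fintype.mem_piFinset] at hc
  have hWR : (W : ℝ) ≠ 0 := by exact_mod_cast hW.ne'
  split_ifs with hpure
  · obtain ⟨hsum, x, hx⟩ := hpure
    have hxb : x ∈ b.support := by
      have := hc s₀
      rwa [hx s₀, Finset.inr_mem_disjSum] at this
    have hφx : φ x ≠ 0 := norm_pos_iff.1 (one_pos.trans (hB x (hb hxb)))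
    have hsum1 : ∑ s, (((w s / W : ℝ)) : ℂ) = 1 := by
      rw [← Complex.ofReal_sum, ← Finset.sum_div, ← Nat.cast_sum, hsum, div_self hWR,
        Complex.ofReal_one]
    have hcoef : ∀ q : ℕ, ∏ s, perturbedCoeff φ (a s) b (w s / W) q (c s) = b x / φ x ^ q := by
      intro q
      simp only [hx, perturbedCoeff, Sum.elim_inr]
      rw [← Complex.exp_sum, ← Finset.sum_mul, hsum1, one_mul, Complex.exp_sub,
        Complex.exp_nat_mul, Complex.exp_log hφx, Complex.exp_log (Finsupp.mem_support_iff.1 hxb)]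
    have hpt : ∑ s, scaledPoint (w s / W) (c s) = x := by
      simp only [hx, scaledPoint, Sum.elim_inr]
      rw [← Finset.sum_mul, hsum1, one_mul]
    refine tendsto_const_nhds.congr fun q => ?_
    rw [hpt, hcoef, hx, Sum.elim_inr, mul_div_cancel₀ _ (pow_ne_zero q hφx)]
  · have hlt := hAB c (fun s => by
      have := hc s
      rcases h : c s with y | x <;> rw [h] at this
      · exact ha s (Finset.inl_mem_disjSum.1 this)
      · exact hb (Finset.inr_mem_disjSum.1 this)) hpure
    rw [← zero_smul ℂ (E (∑ s, scaledPoint (w s / W) (c s)))]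
    refine Tendsto.smul_const ?_ _
    set θ := ‖φ (∑ s, scaledPoint (w s / W) (c s))‖ *
      Real.exp (-∑ s, decayRate φ (w s / W) (c s)) with hθ
    have hθ1 : θ < 1 := by
      rw [hθ, Real.exp_neg, ← div_eq_mul_inv]
      exact (div_lt_one (Real.exp_pos _)).2 hlt
    have hθ0 : 0 ≤ θ := by positivity
    rw [tendsto_zero_iff_norm_tendsto_zero]
    have := (tendsto_pow_atTop_nhds_zero_of_lt_one hθ0 hθ1).mul_const
      (∏ s, ‖perturbedCoeff φ (a s) b (w s / W) 0 (c s)‖)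
    rw [zero_mul] at this
    refine this.congr fun q => ?_
    rw [norm_mul, norm_pow, norm_prod]
    simp only [norm_perturbedCoeff φ (a _) b _ q]
    rw [Finset.prod_mul_distrib, Finset.prod_pow, ← Real.exp_sum, Finset.sum_neg_distrib, hθ,
      mul_pow]
    ring

lemma tendsto_perturbedSum {E : ℂ → X} {φ : ℂ → ℂ} {a b : ℂ →₀ ℂ} {ρ : ℝ} (hρ : 0 < ρ)
    (hb : ∀ x ∈ b.support, 1 < ‖φ x‖) :
    Tendsto (perturbedSum E φ a b ρ) atTop (𝓝 (∑ y ∈ a.support, a y • E y)) := by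
  unfold perturbedSum
  simp only [Finset.sum_disjSum]
  rw [← add_zero (∑ y ∈ a.support, a y • E y)]
  refine Tendsto.add ?_ ?_
  · exact tendsto_const_nhds
  · rw [← Finset.sum_const_zero (s := b.support)]
    refine tendsto_finsetSum _ fun x hx => ?_
    rw [← zero_smul ℂ (E (scaledPoint ρ (Sum.inr x)))]
    refine Tendsto.smul_const ?_ _
    rw [tendsto_zero_iff_norm_tendsto_zero]
    have h1 : Real.exp (-decayRate φ ρ (Sum.inr x)) < 1 := by
      rw [Real.exp_lt_one_iff, neg_lt_zero]
      exact mul_pos hρ (Real.log_pos (hb x hx))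
    have := (tendsto_pow_atTop_nhds_zero_of_lt_one (Real.exp_pos _).le h1).const_mul
      ‖perturbedCoeff φ a b ρ 0 (Sum.inr x)‖
    rw [mul_zero] at this
    exact this.congr fun q => (norm_perturbedCoeff φ a b ρ q (Sum.inr x)).symm

end Algebra

/-! ### Separating weights and factors of monomials. -/

/-- Uniqueness of digits in base `D`: reduce modulo `D`, cancel, divide. -/
lemma eq_of_sum_mul_pow_eq {D : ℕ} : ∀ (n : ℕ) {a b : ℕ → ℕ}, (∀ i, a i < D) → (∀ i, b i < D) →
    ∑ i ∈ Finset.range n, a i * D ^ i = ∑ i ∈ Finset.range n, b i * D ^ i → ∀ i < n, a i = b i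
  | 0, _, _, _, _, _ => fun i hi => absurd hi (Nat.not_lt_zero i)
  | n + 1, a, b, ha, hb, h => by
    have hsplit : ∀ c : ℕ → ℕ, ∑ i ∈ Finset.range (n + 1), c i * D ^ i =
        D * ∑ i ∈ Finset.range n, c (i + 1) * D ^ i + c 0 := fun c => by
      rw [Finset.sum_range_succ', Finset.mul_sum, pow_zero, mul_one]
      congr 1
      exact Finset.sum_congr rfl fun i _ => by ring
    rw [hsplit, hsplit] at h
    have h0 : a 0 = b 0 := by
      have := congrArg (· % D) h
      simpa [Nat.mul_add_mod, Nat.mod_eq_of_lt (ha 0), Nat.mod_eq_of_lt (hb 0)] using this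
    rw [h0] at h
    have h1 := Nat.eq_of_mul_eq_mul_left ((Nat.zero_le _).trans_lt (ha 0)) (Nat.add_right_cancel h)
    have ih := eq_of_sum_mul_pow_eq n (fun i => ha (i + 1)) (fun i => hb (i + 1)) h1
    rintro (_ | i) hi
    · exact h0
    · exact ih i (Nat.lt_of_succ_lt_succ hi)

/-- Positive integer weights that separate finitely many exponents. -/
lemma exists_injOn_weight (A : Finset (ℕ →₀ ℕ)) : ∃ w : ℕ → ℕ, (∀ i, 0 < w i) ∧
    Set.InjOn (fun α : ℕ →₀ ℕ => α.sum fun i k => k * w i) A := by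
  set D := (A.sup fun α => α.support.sup α) + 1 with hD
  set n := (A.sup fun α => α.support.sup id) + 1 with hn
  have hlt : ∀ α ∈ A, ∀ i, α i < D := by
    intro α hα i
    by_cases hi : i ∈ α.support
    · have h1 : α i ≤ α.support.sup α := Finset.le_sup hi
      have h2 : α.support.sup α ≤ A.sup fun α => α.support.sup α :=
        Finset.le_sup (f := fun α : ℕ →₀ ℕ => α.support.sup α) hα
      omega
    · rw [Finsupp.notMem_support_iff.1 hi]
      omega
  have hsupp : ∀ α ∈ A, α.support ⊆ Finset.range n := by
    intro α hα i hi
    have h1 : i ≤ α.support.sup id := Finset.le_sup (f := id) hi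
    have h2 : α.support.sup id ≤ A.sup fun α => α.support.sup id :=
      Finset.le_sup (f := fun α : ℕ →₀ ℕ => α.support.sup id) hα
    rw [Finset.mem_range]
    omega
  -- An exponent is read as a string of base-`D` digits; `D` exceeds every entry occurring in `A`.
  refine ⟨fun i => D ^ i, fun i => pow_pos (Nat.succ_pos _) i, fun α hα β hβ h => ?_⟩
  simp only at h
  rw [Finsupp.sum_of_support_subset _ (hsupp α hα) _ (by simp),
    Finsupp.sum_of_support_subset _ (hsupp β hβ) _ (by simp)] at h
  have := eq_of_sum_mul_pow_eq n (hlt α hα) (hlt β hβ) h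
  ext i
  by_cases hi : i < n
  · exact this i hi
  · have hi' : i ∉ Finset.range n := by simpa using hi
    rw [Finsupp.notMem_support_iff.1 fun h => hi' (hsupp α hα h),
      Finsupp.notMem_support_iff.1 fun h => hi' (hsupp β hβ h)]

/-- The factors of the monomial with exponent `α`. -/
abbrev MonomialFactor (α : ℕ →₀ ℕ) : Type := Σ i : α.support, Fin (α i)

lemma prod_monomialFactor {M : Type*} [CommMonoid M] (α : ℕ →₀ ℕ) (f : ℕ → M) :
    ∏ s : MonomialFactor α, f s.1 = α.prod fun i k => f i ^ k := by
  rw [Fintype.prod_sigma, Finsupp.prod, ← Finset.prod_coe_sort α.support fun i => f i ^ α i]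
  simp

lemma sum_monomialFactor (α : ℕ →₀ ℕ) (f : ℕ → ℕ) :
    ∑ s : MonomialFactor α, f s.1 = α.sum fun i k => k * f i := by
  rw [Fintype.sum_sigma, Finsupp.sum, ← Finset.sum_coe_sort α.support fun i => α i * f i]
  simp

lemma nonempty_monomialFactor {α : ℕ →₀ ℕ} (hα : α ≠ 0) : Nonempty (MonomialFactor α) := by
  obtain ⟨i, hi⟩ := Finsupp.support_nonempty_iff.2 hα
  exact ⟨⟨⟨i, hi⟩, ⟨0, Nat.pos_of_ne_zero (Finsupp.mem_support_iff.1 hi)⟩⟩⟩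

/-! ### Density of the hitting sets. -/

section Hypercyclic

variable {X : Type*} [CommRing X] [Algebra ℂ X] [TopologicalSpace X] [IsTopologicalRing X]
  [ContinuousSMul ℂ X]

/-- The sequences at which some iterate of `T` sends the monomial `β` into `V` and the other
monomials with exponents in `A` into `N`. -/
def hittingSet (T : X → X) (A : Finset (ℕ →₀ ℕ)) (β : ℕ →₀ ℕ) (V N : Set X) : Set (ℕ → X) :=
  {f | ∃ q : ℕ, T^[q] (β.prod fun i k => f i ^ k) ∈ V ∧
    ∀ α ∈ A, α ≠ β → T^[q] (α.prod fun i k => f i ^ k) ∈ N}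

omit [Algebra ℂ X] [ContinuousSMul ℂ X] in
lemma isOpen_hittingSet {T : X → X} (hT : Continuous T) (A : Finset (ℕ →₀ ℕ)) (β : ℕ →₀ ℕ)
    {V N : Set X} (hV : IsOpen V) (hN : IsOpen N) : IsOpen (hittingSet T A β V N) := by
  have hcont : ∀ (q : ℕ) (α : ℕ →₀ ℕ),
      Continuous fun f : ℕ → X => T^[q] (α.prod fun i k => f i ^ k) := fun q α =>
    (hT.iterate q).comp (continuous_finsetProd _ fun i _ => (continuous_apply i).pow _)
  have : hittingSet T A β V N = ⋃ q : ℕ, ((fun f => T^[q] (β.prod fun i k => f i ^ k)) ⁻¹' V) ∩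
      ⋂ α ∈ A, ⋂ _ : α ≠ β, (fun f => T^[q] (α.prod fun i k => f i ^ k)) ⁻¹' N := by
    ext f
    simp [hittingSet]
  rw [this]
  refine isOpen_iUnion fun q => (hV.preimage (hcont q β)).inter ?_
  refine isOpen_biInter_finset fun α _ => isOpen_iInter_of_finite fun _ => hN.preimage (hcont q α)

/-- The heaviest exponent serves as `β`. It is fixed before `V` and `N`, since hypercyclicity of one
polynomial value needs all targets reached through the same monomial. -/
theorem exists_dense_hittingSet {T : X →L[ℂ] X} {E : ℂ → X} {φ : ℂ → ℂ}
    (hφ : Differentiable ℂ φ) (hφ0 : ‖φ 0‖ = 1) (hE0 : E 0 = 1)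
    (hE : ∀ z w, E z * E w = E (z + w)) (hT : ∀ z, T (E z) = φ z • E z)
    (hc : ∀ Λ : Set ℂ, (∃ z : ℂ, AccPt z (𝓟 Λ)) →
      Dense (Submodule.span ℂ (E '' Λ) : Set X)) {e : ℂ}
    {r R : ℝ} (hr : 0 < r) (hR : 0 < R) (hlt : ∀ t : ℝ, 0 < t → t < r → ‖φ (t * e)‖ < 1)
    (hgt : 1 < ‖φ (R * e)‖) (A : Finset (ℕ →₀ ℕ)) (hA : A.Nonempty) (hA0 : 0 ∉ A) :
    ∃ β ∈ A, ∀ V N : Set X, IsOpen V → V.Nonempty → IsOpen N → 0 ∈ N →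
      Dense (hittingSet T A β V N) := by
  classical
  obtain ⟨w, hw, hinj⟩ := exists_injOn_weight A
  obtain ⟨β, hβ, hmax⟩ := A.exists_max_image (fun α => α.sum fun i k => k * w i) hA
  refine ⟨β, hβ, fun V N hV hVne hN hN0 => ?_⟩
  set W := β.sum fun i k => k * w i with hWdef
  have hne : ∀ α ∈ A, Nonempty (MonomialFactor α) := fun α hα =>
    nonempty_monomialFactor fun h => hA0 (h ▸ hα)
  have hsumW : ∀ α : ℕ →₀ ℕ,
      ∑ s : MonomialFactor α, w s.1 = α.sum fun i k => k * w i := fun α =>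
    sum_monomialFactor α w
  have hW : 0 < W := by
    have := hne β hβ
    rw [hWdef, ← hsumW]
    exact Finset.sum_pos (fun s _ => hw _) Finset.univ_nonempty
  have hWR : (0 : ℝ) < W := by exact_mod_cast hW
  obtain ⟨P, Q, hP, hQ, hQ1, hPQ⟩ := exists_spectral_sets hφ hφ0 hr hR hlt hgt hW
  obtain ⟨g, hgV, hg⟩ := (hc Q hQ).inter_open_nonempty V hV hVne
  obtain ⟨b, hbQ, rfl⟩ := (Finsupp.mem_span_image_iff_linearCombination ℂ).1 hg
  rw [dense_iff_inter_open]
  intro U hU hUne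
  have hdense : Dense (Set.pi Set.univ fun _ : ℕ => (Submodule.span ℂ (E '' P) : Set X)) :=
    dense_pi _ fun _ _ => hc P hP
  obtain ⟨u, huU, hu⟩ := hdense.inter_open_nonempty U hU hUne
  have hu' : ∀ i, ∃ a ∈ Finsupp.supported ℂ ℂ P, Finsupp.linearCombination ℂ E a = u i := fun i =>
    (Finsupp.mem_span_image_iff_linearCombination ℂ).1 (hu i (Set.mem_univ i))
  choose a haP hau using hu'
  set F : ℕ → ℕ → X := fun q i => perturbedSum E φ (a i) b (w i / W) q with hF
  have hFu : Tendsto F atTop (𝓝 u) := by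
    rw [tendsto_pi_nhds]
    intro i
    rw [← hau i, Finsupp.linearCombination_apply]
    exact tendsto_perturbedSum (div_pos (by exact_mod_cast hw i) hWR) fun x hx => hQ1 x (hbQ hx)
  have hlim : ∀ α ∈ A, Tendsto (fun q => T^[q] (α.prod fun i k => F q i ^ k)) atTop
      (𝓝 (if (α.sum fun i k => k * w i) = W then ∑ x ∈ b.support, b x • E x else 0)) := by
    intro α hα
    have := hne α hα
    have h := tendsto_iterate_prod_perturbedSum (T := T) hE0 hE hT hW (A := P) (B := Q)
      (fun s : MonomialFactor α => w s.1) hQ1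
      (fun c hc hnp => hPQ _ _ c (fun s => hw _) ((hsumW α).trans_le (hmax α hα)) hc hnp)
      (fun s => a s.1) b (fun s => haP _) hbQ
    rw [hsumW] at h
    refine h.congr fun q => ?_
    rw [← prod_monomialFactor α (F q)]
  have hev : ∀ᶠ q in atTop, F q ∈ U ∧ T^[q] (β.prod fun i k => F q i ^ k) ∈ V ∧
      ∀ α ∈ A, α ≠ β → T^[q] (α.prod fun i k => F q i ^ k) ∈ N := by
    refine (hFu.eventually (hU.mem_nhds huU)).and (Eventually.and ?_ ?_)
    · have := hlim β hβ
      rw [if_pos rfl] at this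
      exact this.eventually (hV.mem_nhds hgV)
    · refine (Filter.eventually_all_finset A).2 fun α hα => ?_
      by_cases hαβ : α = β
      · exact Eventually.of_forall fun q h => absurd hαβ h
      · have := hlim α hα
        -- Separation of weights: only `β` has weight `W`, so the other monomials tend to 0.
        rw [if_neg fun h => hαβ (hinj hα hβ h)] at this
        filter_upwards [this.eventually (hN.mem_nhds hN0)] with q hq using fun _ => hq
  obtain ⟨q, hqU, hqV, hqN⟩ := hev.exists
  exact ⟨F q, hqU, q, hqV, hqN⟩

end Hypercyclic

/-! ### Baire category argument. -/

section Generic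

variable {X : Type*} [CommRing X] [Algebra ℂ X] [TopologicalSpace X] [IsTopologicalRing X]
  [ContinuousSMul ℂ X]

omit [ContinuousSMul ℂ X] in
/-- If the iterates of a monomial with nonzero coefficient reach every open set while those of the
other monomials become small, the value of the polynomial is hypercyclic. -/
lemma isHypercyclicVector_aeval [FirstCountableTopology X] {T : X →L[ℂ] X} {f : ℕ → X}
    {p : MvPolynomial ℕ ℂ} {β : ℕ →₀ ℕ} (hβ : β ∈ p.support)
    (h : ∀ V N : Set X, IsOpen V → V.Nonempty → IsOpen N → 0 ∈ N →
      f ∈ hittingSet T p.support β V N) :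
    IsHypercyclicVector T (MvPolynomial.aeval f p) := by
  classical
  have hc : p.coeff β ≠ 0 := MvPolynomial.mem_support_iff.1 hβ
  have hexp : ∀ q : ℕ, T^[q] (MvPolynomial.aeval f p) =
      p.coeff β • T^[q] (β.prod fun i k => f i ^ k) +
        ∑ α ∈ p.support.erase β, p.coeff α • T^[q] (α.prod fun i k => f i ^ k) := by
    intro q
    have hpow : T^[q] = ⇑((T : X →ₗ[ℂ] X) ^ q) := (Module.End.coe_pow _ _).symm
    rw [hpow, Finset.add_sum_erase p.support
      (fun α => p.coeff α • ((T : X →ₗ[ℂ] X) ^ q) (α.prod fun i k => f i ^ k)) hβ,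
      MvPolynomial.aeval_def, MvPolynomial.eval₂_eq, map_sum]
    refine Finset.sum_congr rfl fun α _ => ?_
    rw [← Algebra.smul_def, map_smul, Finsupp.prod]
  intro u
  -- The target is divided by the coefficient of `β`, which multiplies the surviving monomial.
  obtain ⟨V, hV⟩ := (𝓝 ((p.coeff β)⁻¹ • u)).exists_antitone_basis
  obtain ⟨N, hN⟩ := (𝓝 (0 : X)).exists_antitone_basis
  have hit : ∀ n, ∃ q : ℕ, T^[q] (β.prod fun i k => f i ^ k) ∈ V n ∧
      ∀ α ∈ p.support, α ≠ β → T^[q] (α.prod fun i k => f i ^ k) ∈ N n := by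
    intro n
    obtain ⟨q, hq, hq'⟩ := h (interior (V n)) (interior (N n)) isOpen_interior
      ⟨_, mem_interior_iff_mem_nhds.2 (hV.1.mem_of_mem trivial)⟩ isOpen_interior
      (mem_interior_iff_mem_nhds.2 (hN.1.mem_of_mem trivial))
    exact ⟨q, interior_subset hq, fun α hα hαβ => interior_subset (hq' α hα hαβ)⟩
  choose q hqV hqN using hit
  have h1 : Tendsto (fun n => T^[q n] (β.prod fun i k => f i ^ k)) atTop
      (𝓝 ((p.coeff β)⁻¹ • u)) := hV.tendsto hqV
  have h2 : ∀ α ∈ p.support.erase β,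
      Tendsto (fun n => T^[q n] (α.prod fun i k => f i ^ k)) atTop (𝓝 0) := fun α hα =>
    hN.tendsto fun n => hqN n α (Finset.mem_of_mem_erase hα) (Finset.ne_of_mem_erase hα)
  have h3 : Tendsto (fun n => T^[q n] (MvPolynomial.aeval f p)) atTop (𝓝 u) := by
    simp only [hexp]
    have := (h1.const_smul (p.coeff β)).add
      (tendsto_finsetSum _ fun α hα => (h2 α hα).const_smul (p.coeff α))
    simpa [smul_smul, hc] using this
  exact mem_closure_of_tendsto h3 (Eventually.of_forall fun n => ⟨q n, rfl⟩)

-- Changing a single coordinate far out is a small change in the product topology.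
omit [CommRing X] [Algebra ℂ X] [IsTopologicalRing X] [ContinuousSMul ℂ X] in
lemma dense_setOf_exists_apply_mem {V : Set X} (hV : V.Nonempty) :
    Dense {f : ℕ → X | ∃ i, f i ∈ V} := by
  obtain ⟨v, hv⟩ := hV
  intro f
  have : Tendsto (fun n : ℕ => Function.update f n v) atTop (𝓝 f) := by
    rw [tendsto_pi_nhds]
    intro i
    refine tendsto_const_nhds.congr' ?_
    filter_upwards [eventually_gt_atTop i] with n hn
    rw [Function.update_of_ne hn.ne]
  refine mem_closure_of_tendsto this (Eventually.of_forall fun n => ⟨n, ?_⟩)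
  rwa [Function.update_self]

-- There are countably many exponent sets, and basic open `V` and `N` suffice, so only countably
-- many dense open sets are intersected.
omit [ContinuousSMul ℂ X] in
theorem exists_dense_isGδ_hypercyclic [IsCompletelyMetrizableSpace X] [SeparableSpace X]
    {T : X →L[ℂ] X}
    (h : ∀ A : Finset (ℕ →₀ ℕ), A.Nonempty → 0 ∉ A → ∃ β ∈ A, ∀ V N : Set X, IsOpen V →
      V.Nonempty → IsOpen N → 0 ∈ N → Dense (hittingSet T A β V N)) :
    ∃ G : Set (ℕ → X), IsGδ G ∧ Dense G ∧ ∀ f ∈ G, DenseRange f ∧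
      ∀ p : MvPolynomial ℕ ℂ, p ≠ 0 → MvPolynomial.constantCoeff p = 0 →
        IsHypercyclicVector T (MvPolynomial.aeval f p) := by
  let _ := upgradeIsCompletelyMetrizable X
  have : SecondCountableTopology X := UniformSpace.secondCountable_of_separable X
  have hbasis := isBasis_countableBasis X
  let I := {A : Finset (ℕ →₀ ℕ) // A.Nonempty ∧ 0 ∉ A}
  let J := {V : Set X // V ∈ countableBasis X}
  let K := {N : J // (0 : X) ∈ N.1}
  have : Countable J := (countable_countableBasis X).to_subtype
  choose β hβ hdense using fun A : I => h A.1 A.2.1 A.2.2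
  have hJne : ∀ V : J, V.1.Nonempty := fun V => nonempty_of_mem_countableBasis V.2
  have hJo : ∀ V : J, IsOpen V.1 := fun V => isOpen_of_mem_countableBasis V.2
  have hopen₁ : ∀ t : I × J × K, IsOpen (hittingSet T t.1.1 (β t.1) t.2.1.1 t.2.2.1.1) :=
    fun t => isOpen_hittingSet T.continuous _ _ (hJo _) (hJo _)
  have hopen₂ : ∀ V : J, IsOpen {f : ℕ → X | ∃ i, f i ∈ V.1} := fun V => by
    simp only [Set.ofPred_exists]
    exact isOpen_iUnion fun i => (hJo V).preimage (continuous_apply i)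
  have hd₁ : Dense (⋂ t : I × J × K, hittingSet T t.1.1 (β t.1) t.2.1.1 t.2.2.1.1) :=
    dense_iInter_of_isOpen hopen₁ fun t =>
      hdense t.1 _ _ (hJo _) (hJne _) (hJo _) t.2.2.2
  have hd₂ : Dense (⋂ V : J, {f : ℕ → X | ∃ i, f i ∈ V.1}) :=
    dense_iInter_of_isOpen hopen₂ fun V => dense_setOf_exists_apply_mem (hJne V)
  have hG₁ := IsGδ.iInter_of_isOpen hopen₁
  have hG₂ := IsGδ.iInter_of_isOpen hopen₂
  refine ⟨_, hG₁.inter hG₂, hd₁.inter_of_Gδ hG₁ hG₂ hd₂, fun f hf => ⟨?_, fun p hp hp0 => ?_⟩⟩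
  · rw [DenseRange, hbasis.dense_iff]
    intro V hV _
    obtain ⟨i, hi⟩ := Set.mem_iInter.1 hf.2 ⟨V, hV⟩
    exact ⟨f i, hi, i, rfl⟩
  · let A : I := ⟨p.support, by rwa [Finset.nonempty_iff_ne_empty, Ne, MvPolynomial.support_eq_empty],
      fun h0 => MvPolynomial.mem_support_iff.1 h0 hp0⟩
    refine isHypercyclicVector_aeval (hβ A) fun V N hV hVne hN hN0 => ?_
    obtain ⟨v, hv⟩ := hVne
    obtain ⟨V', hV', -, hVV'⟩ := hbasis.exists_subset_of_mem_open hv hV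
    obtain ⟨N', hN', h0N', hNN'⟩ := hbasis.exists_subset_of_mem_open hN0 hN
    obtain ⟨q, hq, hq'⟩ := Set.mem_iInter.1 hf.1 (A, ⟨V', hV'⟩, ⟨⟨N', hN'⟩, h0N'⟩)
    exact ⟨q, hVV' hq, fun α hα hαβ => hNN' (hq' α hα hαβ)⟩

end Generic

/-! ### Generated subalgebras and reduction to the unital case. -/

lemma exists_aeval_eq_of_mem_adjoin {X : Type*} [CommRing X] [Algebra ℂ X] {ι : Type*} {f : ι → X}
    {g : X} (hg : g ∈ NonUnitalAlgebra.adjoin ℂ (Set.range f)) :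
    ∃ p : MvPolynomial ι ℂ, MvPolynomial.constantCoeff p = 0 ∧ MvPolynomial.aeval f p = g := by
  induction hg using NonUnitalAlgebra.adjoin_induction with
  | mem x hx =>
    obtain ⟨i, rfl⟩ := hx
    exact ⟨MvPolynomial.X i, by simp, MvPolynomial.aeval_X f i⟩
  | zero => exact ⟨0, map_zero _, map_zero _⟩
  | add x y _ _ hx hy =>
    obtain ⟨p, hp, rfl⟩ := hx
    obtain ⟨q, hq, rfl⟩ := hy
    exact ⟨p + q, by rw [map_add, hp, hq, add_zero], map_add _ _ _⟩
  | mul x y _ _ hx hy =>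
    obtain ⟨p, hp, rfl⟩ := hx
    obtain ⟨q, hq, rfl⟩ := hy
    exact ⟨p * q, by rw [map_mul, hp, zero_mul], map_mul _ _ _⟩
  | smul c x _ hx =>
    obtain ⟨p, hp, rfl⟩ := hx
    exact ⟨c • p, by rw [MvPolynomial.constantCoeff_smul, hp, smul_zero], map_smul _ _ _⟩

/-- When `X` is unital, its identity map extends to an algebra homomorphism from the unitization,
which carries one evaluation to the other. -/
lemma aeval_unitization_eq_zero {X : Type*} [CommRing X] [Algebra ℂ X] {ι : Type*} {f : ι → X}
    {p : MvPolynomial ι ℂ}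
    (hp : MvPolynomial.aeval (fun i => (f i : Unitization ℂ X)) p = 0) :
    MvPolynomial.aeval f p = 0 := by
  have h := congrArg (Unitization.lift (NonUnitalAlgHom.id ℂ X)) hp
  rw [map_zero, MvPolynomial.comp_aeval_apply] at h
  simpa using h

theorem exists_dense_isGδ_freelyGeneratesDense {X : Type*} [CommRing X] [Algebra ℂ X]
    [TopologicalSpace X] [IsTopologicalRing X] [ContinuousSMul ℂ X] [Nontrivial X]
    [IsCompletelyMetrizableSpace X] [SeparableSpace X]
    {T : X →L[ℂ] X} {E : ℂ → X} {φ : ℂ → ℂ}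
    (hφ : Differentiable ℂ φ) (hφ0 : ‖φ 0‖ = 1) (hE0 : E 0 = 1)
    (hE : ∀ z w, E z * E w = E (z + w)) (hT : ∀ z, T (E z) = φ z • E z)
    (hc : ∀ Λ : Set ℂ, (∃ z : ℂ, AccPt z (𝓟 Λ)) →
      Dense (Submodule.span ℂ (E '' Λ) : Set X)) {e : ℂ}
    {r R : ℝ} (hr : 0 < r) (hR : 0 < R) (hlt : ∀ t : ℝ, 0 < t → t < r → ‖φ (t * e)‖ < 1)
    (hgt : 1 < ‖φ (R * e)‖) :
    ∃ G : Set (ℕ → X), IsGδ G ∧ Dense G ∧ ∀ f ∈ G,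
      FreelyGeneratesDense f ∧
      ∀ g ∈ NonUnitalAlgebra.adjoin ℂ (Set.range f), g ≠ 0 → IsHypercyclicVector T g := by
  obtain ⟨G, hGδ, hGd, hG⟩ := exists_dense_isGδ_hypercyclic fun A hA hA0 =>
    exists_dense_hittingSet hφ hφ0 hE0 hE hT hc hr hR hlt hgt A hA hA0
  refine ⟨G, hGδ, hGd, fun f hf => ⟨⟨fun p hp0 hp => ?_, ?_⟩, fun g hg hg0 => ?_⟩⟩
  -- A relation `p(f) = 0` would make 0 hypercyclic, impossible in a nontrivial Hausdorff space.
  · by_contra hpne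
    have hyp := (hG f hf).2 p hpne hp0
    have hrange : (Set.range fun n : ℕ => T^[n] (MvPolynomial.aeval f p)) ⊆ {0} := by
      rintro _ ⟨n, rfl⟩
      simp only [aeval_unitization_eq_zero hp, Set.mem_singleton_iff]
      exact Function.iterate_fixed (map_zero T) n
    obtain ⟨x, hx⟩ := exists_ne (0 : X)
    have hclosure := (hyp.mono hrange) x
    rw [closure_singleton] at hclosure
    exact hx hclosure
  · exact (hG f hf).1.mono (NonUnitalAlgebra.subset_adjoin ℂ)
  · obtain ⟨p, hp0, rfl⟩ := exists_aeval_eq_of_mem_adjoin hg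
    exact (hG f hf).2 p (fun h => hg0 (by rw [h, map_zero])) hp0

/-- A map with `E z * E w = E (z + w)` whose values span a dense subspace sends `0` to a unit. -/
lemma apply_zero_mul_of_dense_span {X : Type*} [NonUnitalCommRing X] [Module ℂ X]
    [SMulCommClass ℂ X X] [TopologicalSpace X] [T2Space X] [ContinuousMul X] {E : ℂ → X}
    (hE : ∀ z w, E z * E w = E (z + w))
    (hd : Dense (Submodule.span ℂ (E '' Set.univ) : Set X)) (x : X) : E 0 * x = x := by
  refine congrFun (Continuous.ext_on (f := fun x => E 0 * x) (g := fun x => x) hd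
    (continuous_const.mul continuous_id) continuous_id ?_) x
  intro y hy
  induction hy using Submodule.span_induction with
  | mem y hy =>
    obtain ⟨z, -, rfl⟩ := hy
    simp [hE]
  | zero => simp
  | add y z _ _ hy hz => simp only at *; rw [mul_add, hy, hz]
  | smul c y _ hy => simp only at *; rw [mul_smul_comm, hy]

lemma nontrivial_of_isFreeFamily {X : Type*} [NonUnitalCommRing X] [Module ℂ X]
    [IsScalarTower ℂ X X] [SMulCommClass ℂ X X] {ι : Type*} [Nonempty ι] {f : ι → X}
    (hf : IsFreeFamily f) : Nontrivial X := by
  obtain ⟨i⟩ := ‹Nonempty ι›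
  refine ⟨f i, 0, fun h => MvPolynomial.X_ne_zero (R := ℂ) i (hf _ ?_ ?_)⟩
  · simp
  · rw [MvPolynomial.aeval_X, h, Unitization.inr_zero]

theorem theorem4p4
    {X : Type*} [NonUnitalCommRing X] [Module ℂ X] [IsScalarTower ℂ X X] [SMulCommClass ℂ X X]
    [TopologicalSpace X] [IsTopologicalRing X] [ContinuousSMul ℂ X]
    [IsCompletelyMetrizableSpace X] [SeparableSpace X]
    -- `X` supports a dense freely generated subalgebra
    (hX : ∃ S : Set X, S.Nonempty ∧ FreelyGeneratesDense (fun s : S => (s : X)))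
    (T : X →L[ℂ] X) (E : ℂ → X) (φ : ℂ → ℂ)
    (hφ : Differentiable ℂ φ) (hφ0 : ‖φ 0‖ = 1)
    (ha : ∀ z : ℂ, T (E z) = φ z • E z)
    (hb : ∀ z w : ℂ, E z * E w = E (z + w))
    (hc : ∀ Λ : Set ℂ, (∃ z : ℂ, AccPt z (𝓟 Λ)) →
      Dense (Submodule.span ℂ (E '' Λ) : Set X))
    (hd₁ : ∃ N : ℕ, IsLeast {n : ℕ | 1 ≤ n ∧ iteratedDeriv n φ 0 ≠ 0} N ∧ Odd N)
    (hd₂ : ∃ θ ∈ Set.Ico (0 : ℝ) (2 * Real.pi), ∃ r R : ℝ, 0 < r ∧ 0 < R ∧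
      (∀ t : ℝ, 0 < t → t < r → ‖φ (t * Complex.exp (θ * Complex.I))‖ < 1) ∧
      max 1 (EReal.exp (plIndicator φ θ * (R : EReal))) <
        ‖φ (R * Complex.exp (θ * Complex.I))‖ₑ) :
    ∃ G : Set (ℕ → X), IsGδ G ∧ Dense G ∧ ∀ f ∈ G,
      FreelyGeneratesDense f ∧
      ∀ g ∈ NonUnitalAlgebra.adjoin ℂ (Set.range f), g ≠ 0 → IsHypercyclicVector T g := by
  obtain ⟨S, hS, hfree, -⟩ := hX
  obtain ⟨θ, -, r, R, hr, hR, hlt, hgt⟩ := hd₂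
  have hgt' : 1 < ‖φ (R * Complex.exp (θ * Complex.I))‖ := by
    have h1 := (le_max_left _ _).trans_lt hgt
    rwa [← ofReal_norm, ENNReal.one_lt_ofReal] at h1
  have : Nonempty S := hS.to_subtype
  have : Nontrivial X := nontrivial_of_isFreeFamily hfree
  have hone : ∀ x : X, E 0 * x = x :=
    apply_zero_mul_of_dense_span hb (hc Set.univ ⟨0, by
      rw [principal_univ, AccPt, inf_top_eq]
      infer_instance⟩)
  -- With `E 0` as unit, polynomials can be evaluated in `X` itself.
  let _ : CommRing X :=
    { ‹NonUnitalCommRing X› with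
      one := E 0
      one_mul := hone
      mul_one := fun x => (mul_comm x (E 0)).trans (hone x) }
  let _ : Algebra ℂ X := Algebra.ofModule smul_mul_assoc mul_smul_comm
  exact exists_dense_isGδ_freelyGeneratesDense (X := X) (T := T) hφ hφ0 rfl hb ha hc hr hR hlt hgt'
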